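/- Let $f\in\mathbb{Z}[x_1,\dots,x_n]$ be a polynomial of total degree $d\ge 3$, let $f_d$ be its homogeneous part of degree $d$, and let $s$ be the dimension of the critical locus $\{x\in\mathbb{C}^n : \partial f_d/\partial x_1(x)=\dots=\partial f_d/\partial x_n(x)=0\}$ of $f_d$. Write $f-f(0)=\sum_{i\in\mathbb{N}^n}\beta_i x^i$, put $\operatorname{Supp}(f)=\{i\in\mathbb{N}^n : \beta_i\ne 0\}$, and let $\Delta_0(f)\subset\mathbb{R}^n$ be the convex hull of $\operatorname{Supp}(f)+(\mathbb{R}_{\ge 0})^n$. Then there is a unique real number $\sigma_f$ such that the point $(1/\sigma_f,\dots,1/\sigma_f)$ lies in a proper face of $\Delta_0(f)$, and it satisfies $$\sigma_f\ \ge\ \frac{n-s}{d}.$$ Equality $\sigma_f=(n-s)/d$ holds if and only if there are indices $1\le i_1<\dots<i_{n-s}\le n$ and a smooth form $g$ of degree $d$ in $n-s$ variables with integer coefficients (that is, a homogeneous polynomial of degree $d$ whose partial derivatives have the origin as their only common zero in $\mathbb{C}^{n-s}$) such that $$f(x)-f(0)=g(x_{i_1},\dots,x_{i_{n-s}}).$$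 -/

import Mathlib

open scoped Pointwise

/-- The exponent vectors, in `ℝⁿ`, of the monomials that occur in `f - f(0)`. -/
def newtonSupport {n : ℕ} (f : MvPolynomial (Fin n) ℤ) : Set (Fin n → ℝ) :=
  {a | ∃ m ∈ (f - MvPolynomial.C (MvPolynomial.eval 0 f)).support, a = fun i => (m i : ℝ)}

/-- The Newton polyhedron of `f - f(0)` at zero: the convex hull of the sum set of the support
of `f - f(0)` and the nonnegative orthant. -/
def newtonPolyhedron {n : ℕ} (f : MvPolynomial (Fin n) ℤ) : Set (Fin n → ℝ) :=
  convexHull ℝ (newtonSupport f + Set.Ici (0 : Fin n → ℝ))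

/-- `(1/σ, …, 1/σ)` lies in a proper face of the Newton polyhedron of `f - f(0)` at zero.
A face is the set of maximizers on the polyhedron of a linear functional. -/
def IsNewtonSigma {n : ℕ} (f : MvPolynomial (Fin n) ℤ) (σ : ℝ) : Prop :=
  ∃ τ : Set (Fin n → ℝ), IsExposed ℝ (newtonPolyhedron f) τ ∧ τ ≠ newtonPolyhedron f ∧
    (fun _ => 1 / σ) ∈ τ

/-- The critical locus in `ℂⁿ` of an integer polynomial: the common zeros of its partial
derivatives. -/
def critLocus {n : ℕ} (g : MvPolynomial (Fin n) ℤ) : Set (Fin n → ℂ) :=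
  {x | ∀ i, MvPolynomial.aeval x (MvPolynomial.pderiv i g) = 0}

/-- The dimension of an algebraic subset `Z` of `ℂⁿ`: the Krull dimension of its coordinate
ring `ℂ[x₁, …, xₙ] / I(Z)`. -/
noncomputable def algDim {n : ℕ} (Z : Set (Fin n → ℂ)) : WithBot ℕ∞ :=
  ringKrullDim (MvPolynomial (Fin n) ℂ ⧸ MvPolynomial.vanishingIdeal ℂ Z)

/-- `g` is a smooth form of degree `d`: it is homogeneous of degree `d`, and the origin is the
only complex common zero of its partial derivatives. -/
def IsSmoothForm {m : ℕ} (g : MvPolynomial (Fin m) ℤ) (d : ℕ) : Prop :=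
  g.IsHomogeneous d ∧ critLocus g = {0}

open MvPolynomial

/-! A proper face through the diagonal point gives a nonzero weight `w ≥ 0` with every monomial of
`f - f(0)` of weight at least `N = (1/σ) ∑ w`. Let `c` be the largest of the `s + a + 1` smallest
weights. On the subspace of those variables, `∂ᵢ f_d` vanishes identically unless `N ≤ wᵢ + (d - 1)
c`. The critical locus has dimension only `s`, so at least `a + 1` indices `i` satisfy this
inequality (`card_le_add_card_of_weight`), among them one outside the `a` largest weights. This
pairs the `n - s` largest weights with themselves in reverse order (`exists_pairing_of_weight`).
Summing gives `(n - s) N ≤ d ∑ w`, the bound.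

Equality makes every pairing tight. As `d ≠ 2`, the weight is then constant on `n - s` variables and
zero elsewhere, so `f - f(0)` is a form in those variables; a nonzero critical point of that form
would make the critical locus too large. Conversely, the indicator weight of the variables of `g`
bounds `σ` above. -/

/-! ### Codimension of algebraic sets through the origin -/

/-- The automorphism of the polynomial ring that translates by `x`. -/
noncomputable def translateEquiv {n : ℕ} (x : Fin n → ℂ) :
    MvPolynomial (Fin n) ℂ ≃ₐ[ℂ] MvPolynomial (Fin n) ℂ :=
  AlgEquiv.ofAlgHom (aeval fun i => X i + C (x i)) (aeval fun i => X i - C (x i))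
    (by ext i; simp) (by ext i; simp)

theorem height_vanishingIdeal_singleton {n : ℕ} (x : Fin n → ℂ) :
    (vanishingIdeal ℂ {x}).height = (vanishingIdeal ℂ {(0 : Fin n → ℂ)}).height := by
  have h : vanishingIdeal ℂ {x} =
      (vanishingIdeal ℂ {(0 : Fin n → ℂ)}).comap (translateEquiv x : _ ≃+* _) := by
    ext p
    rw [Ideal.mem_comap, mem_vanishingIdeal_singleton_iff, mem_vanishingIdeal_singleton_iff]
    have : (aeval (0 : Fin n → ℂ)).comp (translateEquiv x).toAlgHom = aeval (R := ℂ) x := by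
      ext i; simp [translateEquiv]
    rw [← this]; rfl
  rw [h]
  exact RingEquiv.height_comap _ _

/-- By the Nullstellensatz every maximal ideal is that of a point, and translation gives all of them
the same height. -/
theorem le_height_vanishingIdeal_zero (n : ℕ) :
    (n : WithBot ℕ∞) ≤ (vanishingIdeal ℂ {(0 : Fin n → ℂ)}).height := by
  have h : ringKrullDim (MvPolynomial (Fin n) ℂ) = n := by
    rw [MvPolynomial.ringKrullDim_of_isNoetherianRing, ringKrullDim_eq_zero_of_field]; simp
  rw [← h]
  refine (ringKrullDim_le_iff_isMaximal_height_le _).2 fun M hM => ?_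
  obtain ⟨x, rfl⟩ := eq_vanishingIdeal_singleton_of_isMaximal ℂ hM
  rw [height_vanishingIdeal_singleton]

/-- An algebraic set that contains the common zeros of `r` polynomials, all of them vanishing at
the origin, has codimension at most `r`. -/
theorem le_algDim_add_card {n : ℕ} {Z : Set (Fin n → ℂ)} (T : Finset (MvPolynomial (Fin n) ℂ))
    (h0 : ∀ p ∈ T, aeval (0 : Fin n → ℂ) p = 0)
    (hZ : ∀ x : Fin n → ℂ, (∀ p ∈ T, aeval x p = 0) → x ∈ Z) :
    (n : WithBot ℕ∞) ≤ algDim Z + (T.card : WithBot ℕ∞) := by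
  have h1 := Ideal.height_le_ringKrullDim_quotient_add_encard
    (p := vanishingIdeal ℂ {(0 : Fin n → ℂ)}) (T : Set (MvPolynomial (Fin n) ℂ))
    (fun p hp => (mem_vanishingIdeal_singleton_iff _ _).2 (h0 p hp))
  have h2 : ringKrullDim (MvPolynomial (Fin n) ℂ ⧸ Ideal.span (T : Set (MvPolynomial (Fin n) ℂ)))
      ≤ algDim Z := by
    have h3 : vanishingIdeal ℂ Z ≤ (Ideal.span (T : Set (MvPolynomial (Fin n) ℂ))).radical := by
      rw [← vanishingIdeal_zeroLocus_eq_radical (K := ℂ), zeroLocus_span]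
      exact vanishingIdeal_anti_mono hZ
    rw [ringKrullDim_quotient, ← PrimeSpectrum.zeroLocus_radical, ← ringKrullDim_quotient]
    exact ringKrullDim_le_of_surjective (Ideal.Quotient.factor h3)
      (Ideal.Quotient.factor_surjective h3)
  rw [Set.encard_coe_eq_coe_finsetCard] at h1
  exact (le_height_vanishingIdeal_zero n).trans (h1.trans (add_le_add_left h2 _))

/-! ### The Newton polyhedron and its supporting weights -/

theorem ne_zero_of_mem_support_sub_const {n : ℕ} {f : MvPolynomial (Fin n) ℤ} {m : Fin n →₀ ℕ}
    (hm : m ∈ (f - C (eval 0 f)).support) : m ≠ 0 := by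
  rintro rfl
  rw [mem_support_iff] at hm
  apply hm
  simp [← constantCoeff_eq, eval_zero]

theorem newtonSupport_finite {n : ℕ} (f : MvPolynomial (Fin n) ℤ) :
    (newtonSupport f).Finite := by
  have : newtonSupport f =
      (fun (m : Fin n →₀ ℕ) (i : Fin n) => (m i : ℝ)) '' (f - C (eval 0 f)).support := by
    ext a
    simp only [newtonSupport, Set.mem_ofPred_eq, Set.mem_image, Finset.mem_coe]
    exact ⟨fun ⟨m, hm, h⟩ => ⟨m, hm, h.symm⟩, fun ⟨m, hm, h⟩ => ⟨m, hm, h.symm⟩⟩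
  rw [this]
  exact (Finset.finite_toSet _).image _

theorem newtonPolyhedron_eq {n : ℕ} (f : MvPolynomial (Fin n) ℤ) :
    newtonPolyhedron f = convexHull ℝ (newtonSupport f) + Set.Ici 0 := by
  rw [newtonPolyhedron, convexHull_add, (convex_Ici (0 : Fin n → ℝ)).convexHull_eq]

theorem convex_newtonPolyhedron {n : ℕ} (f : MvPolynomial (Fin n) ℤ) :
    Convex ℝ (newtonPolyhedron f) := convex_convexHull _ _

theorem isClosed_newtonPolyhedron {n : ℕ} (f : MvPolynomial (Fin n) ℤ) :
    IsClosed (newtonPolyhedron f) := by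
  rw [newtonPolyhedron_eq]
  exact isClosed_Ici.add_left_of_isCompact ((newtonSupport_finite f).isCompact_convexHull ℝ)

theorem mem_newtonPolyhedron_of_le {n : ℕ} {f : MvPolynomial (Fin n) ℤ} {x y : Fin n → ℝ}
    (hx : x ∈ newtonPolyhedron f) (hxy : x ≤ y) : y ∈ newtonPolyhedron f := by
  rw [newtonPolyhedron_eq] at hx ⊢
  obtain ⟨a, ha, b, hb, rfl⟩ := hx
  refine ⟨a, ha, y - a, ?_, by simp⟩
  rw [Set.mem_Ici, sub_nonneg]
  exact le_trans (le_add_of_nonneg_right hb) hxy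

theorem monomial_mem_newtonPolyhedron {n : ℕ} {f : MvPolynomial (Fin n) ℤ} {m : Fin n →₀ ℕ}
    (hm : m ∈ (f - C (eval 0 f)).support) : (fun i => (m i : ℝ)) ∈ newtonPolyhedron f := by
  rw [newtonPolyhedron_eq]
  exact ⟨_, subset_convexHull _ _ ⟨m, hm, rfl⟩, 0, Set.mem_Ici.2 le_rfl, by simp⟩

/-- A lower bound for a nonnegative weight on the support extends to the Newton polyhedron. -/
theorem le_weight_of_mem_newtonPolyhedron {n : ℕ} {f : MvPolynomial (Fin n) ℤ} {w : Fin n → ℝ}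
    {N : ℝ} (hw : 0 ≤ w)
    (h : ∀ m ∈ (f - C (eval 0 f)).support, N ≤ ∑ i, w i * (m i : ℝ))
    {x : Fin n → ℝ} (hx : x ∈ newtonPolyhedron f) : N ≤ ∑ i, w i * x i := by
  have hconv : Convex ℝ {x : Fin n → ℝ | N ≤ ∑ i, w i * x i} := by
    refine convex_halfSpace_ge (f := fun x : Fin n → ℝ => ∑ i, w i * x i) ⟨?_, ?_⟩ N
    · intro x y; simp [mul_add, Finset.sum_add_distrib]
    · intro c x; simp only [Pi.smul_apply, smul_eq_mul, Finset.mul_sum]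
      exact Finset.sum_congr rfl fun i _ => by ring
  refine convexHull_min ?_ hconv hx
  rintro _ ⟨_, ⟨m, hm, rfl⟩, b, hb, rfl⟩
  refine (h m hm).trans (Finset.sum_le_sum fun i _ => ?_)
  exact mul_le_mul_of_nonneg_left (le_add_of_nonneg_right (hb i)) (hw i)

theorem one_le_sum_of_mem_newtonPolyhedron {n : ℕ} {f : MvPolynomial (Fin n) ℤ}
    {x : Fin n → ℝ} (hx : x ∈ newtonPolyhedron f) : 1 ≤ ∑ i, x i := by
  have := le_weight_of_mem_newtonPolyhedron (w := 1) (N := 1) zero_le_one (f := f) ?_ hx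
  · simpa using this
  intro m hm
  have h0 := ne_zero_of_mem_support_sub_const hm
  obtain ⟨i, hi⟩ := Finsupp.ne_iff.1 h0
  simp only [Pi.one_apply, one_mul]
  calc (1 : ℝ) ≤ (m i : ℝ) := by exact_mod_cast Nat.one_le_iff_ne_zero.2 hi
    _ ≤ _ := Finset.single_le_sum (f := fun i => (m i : ℝ)) (fun _ _ => by positivity)
      (Finset.mem_univ i)

theorem pos_of_const_mem_newtonPolyhedron {n : ℕ} {f : MvPolynomial (Fin n) ℤ} {t : ℝ}
    (ht : (fun _ => t) ∈ newtonPolyhedron f) : 0 < t := by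
  have := one_le_sum_of_mem_newtonPolyhedron ht
  by_contra! h
  simp only [Finset.sum_const, Finset.card_univ, Fintype.card_fin, nsmul_eq_mul] at this
  nlinarith [mul_nonneg (Nat.cast_nonneg (α := ℝ) n) (neg_nonneg.2 h)]

theorem IsNewtonSigma.mem {n : ℕ} {f : MvPolynomial (Fin n) ℤ} {σ : ℝ} (h : IsNewtonSigma f σ) :
    (fun _ => 1 / σ) ∈ newtonPolyhedron f := by
  obtain ⟨τ, hτ, -, hm⟩ := h
  exact hτ.subset hm

/-- Positivity excludes the degenerate value `1 / 0 = 0`. -/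
theorem IsNewtonSigma.pos {n : ℕ} {f : MvPolynomial (Fin n) ℤ} {σ : ℝ} (h : IsNewtonSigma f σ) :
    0 < σ := one_div_pos.1 (pos_of_const_mem_newtonPolyhedron h.mem)

/-- A proper face through the diagonal point is cut out by a nonzero nonnegative weight. -/
theorem IsNewtonSigma.exists_weight {n : ℕ} {f : MvPolynomial (Fin n) ℤ} {σ : ℝ}
    (h : IsNewtonSigma f σ) :
    ∃ w : Fin n → ℝ, 0 ≤ w ∧ 0 < ∑ i, w i ∧
      ∀ y ∈ newtonPolyhedron f, 1 / σ * ∑ i, w i ≤ ∑ i, w i * y i := by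
  have hp := h.mem
  obtain ⟨τ, hτ, hne, hm⟩ := h
  obtain ⟨l, rfl⟩ := hτ ⟨_, hm⟩
  have hl : ∀ y : Fin n → ℝ, l y = - ∑ i, (- l (Pi.single i 1)) * y i := by
    intro y
    conv_lhs => rw [pi_eq_sum_univ' y]
    rw [map_sum, ← Finset.sum_neg_distrib]
    refine Finset.sum_congr rfl fun i _ => ?_
    simp [map_smul, mul_comm]
  -- The polyhedron is stable under adding basis vectors, so the maximized `l` cannot increase along
  -- them.
  have hw : 0 ≤ fun i => - l (Pi.single i 1) := by
    intro i
    have h1 := hm.2 ((fun _ => 1 / σ) + Pi.single i 1)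
      (mem_newtonPolyhedron_of_le hp (le_add_of_nonneg_right
        (Pi.single_nonneg.2 zero_le_one)))
    rw [map_add] at h1
    simp only [Pi.zero_apply]
    linarith
  refine ⟨_, hw, ?_, fun y hy => ?_⟩
  · refine lt_of_le_of_ne (Finset.sum_nonneg fun i _ => hw i) fun h0 => hne ?_
    have h1 := (Finset.sum_eq_zero_iff_of_nonneg fun i _ => hw i).1 h0.symm
    have h2 : ∀ y, l y = 0 := by
      intro y
      rw [hl, Finset.sum_eq_zero fun i hi => by rw [h1 i hi, zero_mul], neg_zero]
    simp [h2]
  · have h1 := hm.2 y hy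
    rw [hl, hl (fun _ => 1 / σ), ← Finset.sum_mul] at h1
    rw [mul_comm]; linarith

theorem IsNewtonSigma.le_of_mem {n : ℕ} {f : MvPolynomial (Fin n) ℤ} {σ t : ℝ}
    (h : IsNewtonSigma f σ) (ht : (fun _ => t) ∈ newtonPolyhedron f) : 1 / σ ≤ t := by
  obtain ⟨w, -, hw, hN⟩ := h.exists_weight
  have := hN _ ht
  rw [← Finset.sum_mul, mul_comm] at this
  exact le_of_mul_le_mul_left this hw

theorem IsNewtonSigma.unique {n : ℕ} {f : MvPolynomial (Fin n) ℤ} {σ₁ σ₂ : ℝ}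
    (h₁ : IsNewtonSigma f σ₁) (h₂ : IsNewtonSigma f σ₂) : σ₁ = σ₂ := by
  have := le_antisymm (h₁.le_of_mem h₂.mem) (h₂.le_of_mem h₁.mem)
  simpa using this

/-- The diagonal enters the closed polyhedron at a boundary point, and a supporting hyperplane there
cuts out the face. -/
theorem exists_isNewtonSigma {n : ℕ} {f : MvPolynomial (Fin n) ℤ}
    (hf : f - C (eval 0 f) ≠ 0) : ∃ σ, IsNewtonSigma f σ := by
  obtain ⟨m, hm⟩ := support_nonempty.2 hf
  have hΔ := monomial_mem_newtonPolyhedron hm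
  set T : Set ℝ := {t | (fun _ => t) ∈ newtonPolyhedron f} with hT
  have hcont : Continuous fun (t : ℝ) (_ : Fin n) => t := by fun_prop
  have hTc : IsClosed T := (isClosed_newtonPolyhedron f).preimage hcont
  have hTb : BddBelow T := ⟨0, fun t ht => (pos_of_const_mem_newtonPolyhedron ht).le⟩
  have hTn : T.Nonempty := ⟨∑ i, (m i : ℝ), mem_newtonPolyhedron_of_le hΔ fun i =>
    Finset.single_le_sum (f := fun i => (m i : ℝ)) (fun _ _ => by positivity) (Finset.mem_univ i)⟩
  have ht : sInf T ∈ T := hTc.csInf_mem hTn hTb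
  have hni : (fun _ => sInf T) ∉ interior (newtonPolyhedron f) := by
    intro hi
    have h1 := hcont.continuousAt.preimage_mem_nhds (x := sInf T)
      (isOpen_interior.mem_nhds hi)
    obtain ⟨ε, hε, hb⟩ := Metric.mem_nhds_iff.1 h1
    have h2 : sInf T - ε / 2 ∈ Metric.ball (sInf T) ε := by
      rw [Metric.mem_ball, Real.dist_eq]
      rw [abs_lt]; constructor <;> linarith
    have := csInf_le hTb (show sInf T - ε / 2 ∈ T from interior_subset (s := newtonPolyhedron f) (hb h2))
    linarith
  -- Nonempty interior extends the bound on `l` to the whole polyhedron by closure, and makes the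
  -- face proper.
  have hint : (interior (newtonPolyhedron f)).Nonempty := by
    refine ⟨fun i => (m i : ℝ) + 1, mem_interior.2 ⟨Set.univ.pi fun i => Set.Ioi (m i : ℝ), ?_,
      isOpen_set_pi Set.finite_univ fun i _ => isOpen_Ioi, fun i _ => by simp⟩⟩
    intro y hy
    exact mem_newtonPolyhedron_of_le hΔ fun i => (hy i trivial).le
  obtain ⟨l, hl⟩ := geometric_hahn_banach_open_point (convex_newtonPolyhedron f).interior
    isOpen_interior hni
  have hle : ∀ y ∈ newtonPolyhedron f, l y ≤ l fun _ => sInf T := by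
    intro y hy
    have hy' : y ∈ closure (interior (newtonPolyhedron f)) := by
      rw [(convex_newtonPolyhedron f).closure_interior_eq_closure_of_nonempty_interior hint]
      exact subset_closure hy
    exact closure_minimal (fun a ha => (hl a ha).le)
      (isClosed_le l.continuous continuous_const) hy'
  refine ⟨1 / sInf T, {x ∈ newtonPolyhedron f | ∀ y ∈ newtonPolyhedron f, l y ≤ l x},
    fun _ => ⟨l, rfl⟩, fun h => ?_, ?_⟩
  · obtain ⟨a, ha⟩ := hint
    have ha' := interior_subset ha
    rw [← h] at ha'
    exact absurd (ha'.2 _ ht) (not_le.2 (hl a ha))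
  · simp only [one_div_one_div]
    exact ⟨ht, hle⟩

/-! ### Weights of a form against its critical locus -/

theorem sum_eq_of_isHomogeneous {n d : ℕ} {F : MvPolynomial (Fin n) ℤ} (hF : F.IsHomogeneous d)
    {m : Fin n →₀ ℕ} (hm : m ∈ F.support) : ∑ i, m i = d := by
  rw [← Finsupp.degree_eq_sum, Finsupp.degree_eq_weight_one]
  exact hF (mem_support_iff.1 hm)

theorem aeval_zero_pderiv_of_isHomogeneous {n d : ℕ} {F : MvPolynomial (Fin n) ℤ}
    (hF : F.IsHomogeneous d) (hd : 2 ≤ d) (i : Fin n) :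
    aeval (0 : Fin n → ℂ) (pderiv i F) = 0 := by
  rw [aeval_zero, constantCoeff_eq, (hF.pderiv (i := i)).coeff_eq_zero (by simp; omega), map_zero]

theorem aeval_smul_of_isHomogeneous {n k : ℕ} {p : MvPolynomial (Fin n) ℤ}
    (hp : p.IsHomogeneous k) (c : ℂ) (x : Fin n → ℂ) :
    aeval (c • x) p = c ^ k * aeval x p := by
  rw [aeval_def, aeval_def, eval₂_eq', eval₂_eq', Finset.mul_sum]
  refine Finset.sum_congr rfl fun m hm => ?_
  have h : ∑ i, m i = k := sum_eq_of_isHomogeneous hp hm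
  simp only [Pi.smul_apply, smul_eq_mul, mul_pow, Finset.prod_mul_distrib,
    Finset.prod_pow_eq_pow_sum, h]
  ring

/-- The `i`-th partial derivative of a form vanishes on a coordinate subspace if the monomials
that could survive there have too small a weight. -/
theorem aeval_pderiv_eq_zero_of_weight_lt {n d : ℕ} {F : MvPolynomial (Fin n) ℤ}
    (hF : F.IsHomogeneous d) {w : Fin n → ℝ} {N : ℝ}
    (hN : ∀ m ∈ F.support, N ≤ ∑ i, w i * (m i : ℝ)) {S : Finset (Fin n)} {c : ℝ}
    (hc : ∀ i ∈ S, w i ≤ c) {i : Fin n} (hi : w i + ((d : ℝ) - 1) * c < N)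
    {x : Fin n → ℂ} (hx : ∀ j, j ∉ S → x j = 0) : aeval x (pderiv i F) = 0 := by
  classical
  rw [F.as_sum, map_sum, map_sum]
  refine Finset.sum_eq_zero fun m hm => ?_
  rw [pderiv_monomial, aeval_monomial]
  by_cases hmi : m i = 0
  · simp [hmi]
  obtain ⟨m', rfl⟩ : ∃ m', m = Finsupp.single i 1 + m' :=
    ⟨m - Finsupp.single i 1, by
      rw [add_tsub_cancel_of_le]; simpa [Nat.one_le_iff_ne_zero] using hmi⟩
  rw [add_tsub_cancel_left]
  suffices h : ∃ j, j ∉ S ∧ m' j ≠ 0 by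
    obtain ⟨j, hj, hj'⟩ := h
    rw [Finsupp.prod, Finset.prod_eq_zero (Finsupp.mem_support_iff.2 hj') (by simp [hx j hj, hj']),
      mul_zero]
  by_contra! h
  have hdeg := sum_eq_of_isHomogeneous hF hm
  simp only [Finsupp.add_apply, Finset.sum_add_distrib, Finsupp.single_apply,
    Finset.sum_ite_eq, Finset.mem_univ, if_true] at hdeg
  have hdeg' : ∑ j, (m' j : ℝ) = (d : ℝ) - 1 := by
    rw [← hdeg]; push_cast; ring
  have h1 : ∑ j, w j * (m' j : ℝ) ≤ ∑ j, c * (m' j : ℝ) := by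
    refine Finset.sum_le_sum fun j _ => ?_
    by_cases hj : j ∈ S
    · exact mul_le_mul_of_nonneg_right (hc j hj) (by positivity)
    · simp [h j hj]
  rw [← Finset.mul_sum, hdeg'] at h1
  have h2 := hN _ hm
  have h3 : ∑ j, w j * ((Finsupp.single i 1 + m' : Fin n →₀ ℕ) j : ℝ)
      = w i + ∑ j, w j * (m' j : ℝ) := by
    simp [mul_add, Finset.sum_add_distrib, Finsupp.single_apply]
  linarith

theorem card_le_add_card_of_weight {n d s : ℕ} {F : MvPolynomial (Fin n) ℤ}
    (hF : F.IsHomogeneous d) (hd : 2 ≤ d) (hs : algDim (critLocus F) = (s : WithBot ℕ∞))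
    {w : Fin n → ℝ} {N : ℝ}
    (hN : ∀ m ∈ F.support, N ≤ ∑ i, w i * (m i : ℝ)) {S : Finset (Fin n)} {c : ℝ}
    (hc : ∀ i ∈ S, w i ≤ c) :
    S.card ≤ s + (Finset.univ.filter fun i => N ≤ w i + ((d : ℝ) - 1) * c).card := by
  classical
  set B := Finset.univ.filter fun i => N ≤ w i + ((d : ℝ) - 1) * c with hB
  -- The coordinates outside `S` cut out a subspace on which the partials outside `B` vanish
  -- automatically.
  set T : Finset (MvPolynomial (Fin n) ℂ) :=
    Sᶜ.image X ∪ B.image fun i => map (algebraMap ℤ ℂ) (pderiv i F) with hT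
  have h := le_algDim_add_card (Z := critLocus F) T ?_ ?_
  · rw [hs] at h
    have h1 : n ≤ s + T.card := by exact_mod_cast h
    have h2 : T.card ≤ (n - S.card) + B.card := by
      refine (Finset.card_union_le _ _).trans (add_le_add ?_ Finset.card_image_le)
      refine Finset.card_image_le.trans ?_
      rw [Finset.card_compl, Fintype.card_fin]
    have h3 : S.card ≤ n := by simpa using S.card_le_univ
    omega
  · intro p hp
    rcases Finset.mem_union.1 hp with hp | hp
    · obtain ⟨i, -, rfl⟩ := Finset.mem_image.1 hp
      simp
    · obtain ⟨i, -, rfl⟩ := Finset.mem_image.1 hp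
      rw [aeval_map_algebraMap]
      exact aeval_zero_pderiv_of_isHomogeneous hF hd i
  · intro x hx i
    by_cases hi : i ∈ B
    · have := hx _ (Finset.mem_union_right _ (Finset.mem_image_of_mem _ hi))
      rwa [aeval_map_algebraMap] at this
    · refine aeval_pderiv_eq_zero_of_weight_lt hF hN hc (by simpa [hB] using hi) fun j hj => ?_
      have := hx (X j) (Finset.mem_union_left _ (Finset.mem_image_of_mem _ (by simpa using hj)))
      simpa using this

/-- The `n - s` largest weights, in increasing order, satisfy the pairing inequalities. -/
theorem exists_pairing_of_weight {n d s : ℕ} {F : MvPolynomial (Fin n) ℤ}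
    (hF : F.IsHomogeneous d) (hd : 2 ≤ d) (hs : algDim (critLocus F) = (s : WithBot ℕ∞))
    {w : Fin n → ℝ} {N : ℝ}
    (hN : ∀ m ∈ F.support, N ≤ ∑ i, w i * (m i : ℝ)) :
    ∃ κ : Fin (n - s) → Fin n, Function.Injective κ ∧
      ∀ a, N ≤ w (κ a.rev) + ((d : ℝ) - 1) * w (κ a) := by
  classical
  have hmono : Monotone (w ∘ Tuple.sort w) := Tuple.monotone_sort w
  set e := Tuple.sort w
  refine ⟨fun a => e ⟨s + a, by omega⟩, fun a b hab => ?_, fun a => ?_⟩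
  · have := congrArg Fin.val (e.injective hab)
    simp only at this
    ext; omega
  · by_contra! hlt
    set j : Fin n := ⟨s + a, by omega⟩ with hj
    set k : Fin n := ⟨s + a.rev, by omega⟩ with hk
    have h := card_le_add_card_of_weight hF hd hs hN (S := (Finset.Iic j).map e.toEmbedding)
      (c := w (e j)) ?_
    -- If the pairing fails at `a`, only indices sorted strictly after `k = n - 1 - a` qualify: at
    -- most `a` of them, while `h` requires `a + 1`.
    · have h1 : (Finset.univ.filter fun i => N ≤ w i + ((d : ℝ) - 1) * w (e j)) ⊆
          (Finset.Ioi k).map e.toEmbedding := by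
        intro i hi
        obtain ⟨i, rfl⟩ := e.surjective i
        refine Finset.mem_map_of_mem e.toEmbedding (Finset.mem_Ioi.2 ?_)
        by_contra! hik
        have h2 : w (e i) ≤ w (e k) := hmono hik
        have h3 := (Finset.mem_filter.1 hi).2
        linarith
      have h2 := Finset.card_le_card h1
      rw [Finset.card_map, Fin.card_Ioi] at h2
      rw [Finset.card_map, Fin.card_Iic] at h
      have h3 : (k : ℕ) = s + (n - s - (a + 1)) := by rw [hk]; simp [Fin.val_rev]
      have h4 : (j : ℕ) = s + a := rfl
      have := a.isLt
      omega
    · intro i hi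
      obtain ⟨b, hb, rfl⟩ := Finset.mem_map.1 hi
      exact hmono (Finset.mem_Iic.1 hb)

theorem sum_add_mul_rev {k d : ℕ} (u : Fin k → ℝ) :
    ∑ a : Fin k, (u a.rev + ((d : ℝ) - 1) * u a) = d * ∑ a, u a := by
  have h : ∑ a : Fin k, u a.rev = ∑ a, u a := Equiv.sum_comp Fin.revPerm u
  rw [Finset.sum_add_distrib, ← Finset.mul_sum, h]
  ring

theorem sum_le_of_pairing {k n d : ℕ} {w : Fin n → ℝ} {N : ℝ} {κ : Fin k → Fin n}
    (h : ∀ a, N ≤ w (κ a.rev) + ((d : ℝ) - 1) * w (κ a)) :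
    k * N ≤ d * ∑ a, w (κ a) := by
  have h1 := Finset.sum_le_sum fun a (_ : a ∈ Finset.univ) => h a
  rwa [sum_add_mul_rev fun a => w (κ a), Finset.sum_const, Finset.card_univ, Fintype.card_fin,
    nsmul_eq_mul] at h1

theorem sum_comp_le_sum {k n : ℕ} {w : Fin n → ℝ} (hw : 0 ≤ w) {κ : Fin k → Fin n}
    (hκ : Function.Injective κ) : ∑ a, w (κ a) ≤ ∑ i, w i := by
  classical
  rw [← Finset.sum_image (s := Finset.univ) (g := κ) (f := w) (fun a _ b _ h => hκ h)]
  exact Finset.sum_le_sum_of_subset_of_nonneg (Finset.subset_univ _) fun i _ _ => hw i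

/-! ### The case of equality -/

/-- In the case of equality the weight is constant on `n - s` variables and zero on the others. -/
theorem weight_eq_of_pairing_of_eq {k n d : ℕ} (hd : 3 ≤ d) {w : Fin n → ℝ} (hw : 0 ≤ w) {N : ℝ}
    {κ : Fin k → Fin n} (hκ : Function.Injective κ)
    (h : ∀ a, N ≤ w (κ a.rev) + ((d : ℝ) - 1) * w (κ a))
    (heq : (d : ℝ) * ∑ i, w i = k * N) :
    (∀ a, (d : ℝ) * w (κ a) = N) ∧ ∀ i, i ∉ Set.range κ → w i = 0 := by
  classical
  have hd' : (3 : ℝ) ≤ d := by exact_mod_cast hd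
  have h1 := sum_le_of_pairing h
  have h2 := sum_comp_le_sum hw hκ
  have h3 : ∑ a, w (κ a) = ∑ i, w i := by
    refine le_antisymm h2 (le_of_mul_le_mul_left ?_ (by linarith : (0 : ℝ) < d))
    rw [heq]; exact h1
  constructor
  · have h4 : ∑ _a : Fin k, N = ∑ a, (w (κ (Fin.rev a)) + ((d : ℝ) - 1) * w (κ a)) := by
      rw [sum_add_mul_rev fun a => w (κ a), h3, heq, Finset.sum_const, Finset.card_univ,
        Fintype.card_fin, nsmul_eq_mul]
    have h5 := (Finset.sum_eq_sum_iff_of_le fun a _ => h a).1 h4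
    intro a
    have h6 := h5 a (Finset.mem_univ _)
    have h7 := h5 a.rev (Finset.mem_univ _)
    rw [Fin.rev_rev] at h7
    have h8 : w (κ a) = w (κ a.rev) := by
      -- Difference of the tight inequalities at `a` and `a.rev`; this is where `d ≠ 2` matters.
      have : ((d : ℝ) - 2) * (w (κ a) - w (κ a.rev)) = 0 := by linarith
      rcases mul_eq_zero.1 this with h | h <;> linarith
    rw [h6, ← h8]; ring
  · rw [← Finset.sum_image (s := Finset.univ) (g := κ) (f := w) (fun a _ b _ h => hκ h)] at h3
    intro i hi
    by_contra hne
    refine absurd h3 (ne_of_lt (Finset.sum_lt_sum_of_subset (Finset.subset_univ _)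
      (Finset.mem_univ i) (by simpa using hi) (lt_of_le_of_ne (hw i) (Ne.symm hne))
      fun j _ _ => hw j))

/-- The form is smooth in the remaining `n - s` variables. -/
theorem critLocus_eq_singleton_of_rename {n d s : ℕ} (hsn : s < n) (hd : 2 ≤ d)
    {g : MvPolynomial (Fin (n - s)) ℤ} (hg : g.IsHomogeneous d) {ι : Fin (n - s) → Fin n}
    (hι : Function.Injective ι)
    (hs : algDim (critLocus (rename ι g)) = (s : WithBot ℕ∞)) : critLocus g = {0} := by
  classical
  refine Set.eq_singleton_iff_unique_mem.2
    ⟨fun i => aeval_zero_pderiv_of_isHomogeneous hg hd i, fun x hx => ?_⟩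
  by_contra hne
  obtain ⟨a, ha⟩ := Function.ne_iff.1 hne
  -- These `n - s - 1` equations say that the coordinates along `ι` are proportional to `x`. By
  -- homogeneity such points are critical, which forces dimension at least `s + 1`.
  set T : Finset (MvPolynomial (Fin n) ℂ) :=
    (Finset.univ.erase a).image fun b => C (x a) * X (ι b) - C (x b) * X (ι a) with hT
  have h := le_algDim_add_card (Z := critLocus (rename ι g)) T ?_ ?_
  · rw [hs] at h
    have h1 : n ≤ s + T.card := by exact_mod_cast h
    have h2 : T.card ≤ n - s - 1 := by
      refine Finset.card_image_le.trans ?_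
      rw [Finset.card_erase_of_mem (Finset.mem_univ _), Finset.card_univ, Fintype.card_fin]
    omega
  · intro p hp
    obtain ⟨b, -, rfl⟩ := Finset.mem_image.1 hp
    simp
  · intro y hy i
    have hyx : y ∘ ι = (y (ι a) / x a) • x := by
      ext b
      simp only [Function.comp_apply, Pi.smul_apply, smul_eq_mul]
      have ha' : x a ≠ 0 := ha
      by_cases hb : b = a
      · subst hb; field_simp
      · have := hy _ (Finset.mem_image_of_mem _ (Finset.mem_erase.2 ⟨hb, Finset.mem_univ b⟩))
        simp only [map_sub, map_mul, aeval_X, algHom_C, Algebra.algebraMap_self,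
          RingHom.id_apply] at this
        field_simp
        linear_combination this
    by_cases hi : i ∈ Set.range ι
    · obtain ⟨b, rfl⟩ := hi
      rw [pderiv_rename hι, aeval_rename, hyx, aeval_smul_of_isHomogeneous hg.pderiv, hx b,
        mul_zero]
    · rw [pderiv_eq_zero_of_notMem_vars, map_zero]
      intro hi'
      have := vars_rename ι g hi'
      obtain ⟨b, -, rfl⟩ := Finset.mem_image.1 this
      exact hi ⟨b, rfl⟩

theorem sub_const_ne_zero {n d : ℕ} {f : MvPolynomial (Fin n) ℤ} (hd : d ≠ 0)
    (hf : f.totalDegree = d) : f - C (eval 0 f) ≠ 0 := by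
  intro h
  rw [sub_eq_zero] at h
  rw [h, totalDegree_C] at hf
  exact hd hf.symm

theorem mem_support_sub_const {n : ℕ} {f : MvPolynomial (Fin n) ℤ} {m : Fin n →₀ ℕ}
    (hm : m ≠ 0) : m ∈ (f - C (eval 0 f)).support ↔ m ∈ f.support := by
  rw [mem_support_iff, mem_support_iff, coeff_sub, coeff_C, if_neg hm.symm, sub_zero]

theorem support_homogeneousComponent_subset {n d : ℕ} {f : MvPolynomial (Fin n) ℤ} (hd : d ≠ 0) :
    (homogeneousComponent d f).support ⊆ (f - C (eval 0 f)).support := by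
  intro m hm
  rw [mem_support_iff, coeff_homogeneousComponent] at hm
  have h1 : m.degree = d := by by_contra h; simp [h] at hm
  have h2 : m ≠ 0 := by rintro rfl; exact hd (by simpa using h1.symm)
  rw [mem_support_sub_const h2, mem_support_iff]
  simpa [h1] using hm

theorem homogeneousComponent_eq_sub_const {n d : ℕ} {f : MvPolynomial (Fin n) ℤ} (hd : d ≠ 0)
    (h : (f - C (eval 0 f)).IsHomogeneous d) :
    homogeneousComponent d f = f - C (eval 0 f) := by
  conv_lhs => rw [← sub_add_cancel f (C (eval 0 f))]
  rw [map_add, homogeneousComponent_of_mem h, homogeneousComponent_of_mem (isHomogeneous_C _ _)]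
  simp [hd]

/-- For an optimal weight concentrated equally on the range of `κ`, all monomials of `f - f(0)`
have degree `d` and involve only these variables. -/
theorem exists_form_of_weight_eq {n d k : ℕ} {f : MvPolynomial (Fin n) ℤ}
    (hf : f.totalDegree = d) {w : Fin n → ℝ} {N : ℝ} (hNpos : 0 < N)
    (hN : ∀ m ∈ (f - C (eval 0 f)).support, N ≤ ∑ i, w i * (m i : ℝ))
    {κ : Fin k → Fin n} (hκ : Function.Injective κ)
    (h1 : ∀ a, (d : ℝ) * w (κ a) = N) (h2 : ∀ i, i ∉ Set.range κ → w i = 0) :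
    ∃ (g : MvPolynomial (Fin k) ℤ) (ι : Fin k → Fin n), g.IsHomogeneous d ∧ StrictMono ι ∧
      f - C (eval 0 f) = rename ι g := by
  classical
  set R : Finset (Fin n) := Finset.univ.image κ with hR
  have hRc : R.card = k := by
    rw [hR, Finset.card_image_of_injective _ hκ, Finset.card_univ, Fintype.card_fin]
  have hmem : ∀ m ∈ (f - C (eval 0 f)).support, ∑ i, m i = d ∧ ∀ i, i ∉ R → m i = 0 := by
    intro m hm
    have h0 := ne_zero_of_mem_support_sub_const hm
    have hle : ∑ i, m i ≤ d := by
      rw [← hf]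
      have := le_totalDegree ((mem_support_sub_const h0).1 hm)
      rwa [Finsupp.sum_fintype _ _ (fun _ => rfl)] at this
    -- The weight of `m` is `N / d` times its degree in the variables of `R`; total degree at most
    -- `d` then leaves no other variable.
    have hge : d ≤ ∑ i ∈ R, m i := by
      have h3 := mul_le_mul_of_nonneg_left (hN m hm) (Nat.cast_nonneg (α := ℝ) d)
      have h4 : (d : ℝ) * ∑ i, w i * (m i : ℝ) = N * ∑ i ∈ R, (m i : ℝ) := by
        rw [Finset.mul_sum, Finset.mul_sum, ← Finset.sum_subset (Finset.subset_univ R)]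
        · refine Finset.sum_congr rfl fun i hi => ?_
          obtain ⟨a, -, rfl⟩ := Finset.mem_image.1 hi
          rw [← mul_assoc, h1]
        · intro i _ hi
          rw [h2 i (by simpa [hR] using hi)]; simp
      rw [h4, mul_comm] at h3
      exact_mod_cast le_of_mul_le_mul_left h3 hNpos
    have hsplit := Finset.sum_add_sum_compl R fun i => m i
    refine ⟨by omega, fun i hi => ?_⟩
    have h5 : ∑ i ∈ Rᶜ, m i = 0 := by omega
    exact Finset.sum_eq_zero_iff.1 h5 i (Finset.mem_compl.2 hi)
  set ι : Fin k → Fin n := ⇑(R.orderEmbOfFin hRc) with hι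
  have hιm : StrictMono ι := (R.orderEmbOfFin hRc).strictMono
  obtain ⟨g, hg⟩ := exists_rename_eq_of_vars_subset_range (f - C (eval 0 f)) ι hιm.injective (by
    intro i hi
    obtain ⟨m, hm, him⟩ := (mem_vars_iff_mem_support i).1 hi
    rw [hι, Finset.range_orderEmbOfFin]
    by_contra hiR
    exact Finsupp.mem_support_iff.1 him ((hmem m hm).2 i hiR))
  refine ⟨g, ι, ?_, hιm, hg.symm⟩
  rw [← IsHomogeneous.rename_isHomogeneous_iff hιm.injective, hg]
  intro m hm
  rw [← (hmem m (mem_support_iff.2 hm)).1, ← Finsupp.degree_eq_sum, Finsupp.degree_eq_weight_one]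
  rfl

theorem IsNewtonSigma.le_of_eq_rename {n d k : ℕ} {f : MvPolynomial (Fin n) ℤ} {σ : ℝ}
    (hσ : IsNewtonSigma f σ) (hd : d ≠ 0) {g : MvPolynomial (Fin k) ℤ} (hg : g.IsHomogeneous d)
    {ι : Fin k → Fin n} (hι : Function.Injective ι) (h : f - C (eval 0 f) = rename ι g) :
    σ ≤ (k : ℝ) / d := by
  classical
  set w : Fin n → ℝ := fun i => if i ∈ Set.range ι then 1 else 0 with hw
  have hsum : ∀ y : Fin n → ℝ, ∑ i, w i * y i = ∑ a, y (ι a) := by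
    intro y
    simp only [hw, ite_mul, one_mul, zero_mul]
    rw [← Finset.sum_filter, ← Finset.sum_image (g := ι) (f := y) fun a _ b _ h => hι h]
    congr 1
    ext i; simp
  have h1 := le_weight_of_mem_newtonPolyhedron (w := w) (N := d) (f := f)
    (fun i => by simp only [hw]; split_ifs <;> simp) (fun m hm => by
      rw [hsum]
      rw [h] at hm
      rw [support_rename_of_injective hι] at hm
      obtain ⟨m', hm', rfl⟩ := Finset.mem_image.1 hm
      simp only [Finsupp.mapDomain_apply hι]
      exact_mod_cast (sum_eq_of_isHomogeneous hg hm').ge) hσ.mem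
  rw [hsum] at h1
  simp only [Finset.sum_const, Finset.card_univ, Fintype.card_fin, nsmul_eq_mul] at h1
  have hd' : (0 : ℝ) < d := by positivity
  have := hσ.pos
  rw [mul_one_div, le_div_iff₀ this] at h1
  rw [le_div_iff₀ hd']
  linarith

theorem mainTheorem9 (n d s : ℕ) (f : MvPolynomial (Fin n) ℤ)
    (hd : 3 ≤ d) (hf : f.totalDegree = d)
    (hs : algDim (critLocus (MvPolynomial.homogeneousComponent d f)) = (s : WithBot ℕ∞)) :
    (∃! σ : ℝ, IsNewtonSigma f σ) ∧
    ∀ σ : ℝ, IsNewtonSigma f σ →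
      ((n : ℝ) - (s : ℝ)) / (d : ℝ) ≤ σ ∧
      (σ = ((n : ℝ) - (s : ℝ)) / (d : ℝ) ↔
        ∃ (g : MvPolynomial (Fin (n - s)) ℤ) (ι : Fin (n - s) → Fin n),
          IsSmoothForm g d ∧ StrictMono ι ∧
          f - MvPolynomial.C (MvPolynomial.eval 0 f) = MvPolynomial.rename ι g) := by
  have hd0 : d ≠ 0 := by omega
  have hdpos : (0 : ℝ) < d := by positivity
  obtain ⟨σ₀, hσ₀⟩ := exists_isNewtonSigma (sub_const_ne_zero hd0 hf)
  refine ⟨⟨σ₀, hσ₀, fun σ hσ => hσ.unique hσ₀⟩, fun σ hσ => ?_⟩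
  have hσpos := hσ.pos
  -- For `n ≤ s` the truncated `n - s` is zero, and a form in no variables would force `σ ≤ 0`.
  rcases le_or_gt n s with hns | hsn
  · have hneg : ((n : ℝ) - (s : ℝ)) / (d : ℝ) ≤ 0 :=
      div_nonpos_of_nonpos_of_nonneg (sub_nonpos.2 (by exact_mod_cast hns)) hdpos.le
    refine ⟨hneg.trans hσpos.le, fun h => absurd hneg (by rw [← h]; exact not_le.2 hσpos), ?_⟩
    rintro ⟨g, ι, hg, hι, h⟩
    have := hσ.le_of_eq_rename hd0 hg.1 hι.injective h
    rw [Nat.sub_eq_zero_of_le hns, Nat.cast_zero, zero_div] at this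
    exact absurd this (not_le.2 hσpos)
  have hcast : ((n - s : ℕ) : ℝ) = (n : ℝ) - (s : ℝ) := Nat.cast_sub hsn.le
  obtain ⟨w, hw, hwpos, hN⟩ := hσ.exists_weight
  have hN' : ∀ m ∈ (f - C (eval 0 f)).support, 1 / σ * ∑ i, w i ≤ ∑ i, w i * (m i : ℝ) :=
    fun m hm => hN _ (monomial_mem_newtonPolyhedron hm)
  obtain ⟨κ, hκ, hpair⟩ := exists_pairing_of_weight
    (homogeneousComponent_isHomogeneous d f) (by omega) hs
    fun m hm => hN' m (support_homogeneousComponent_subset hd0 hm)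
  have hle : ((n : ℝ) - (s : ℝ)) / (d : ℝ) ≤ σ := by
    have h1 := (sum_le_of_pairing hpair).trans
      (mul_le_mul_of_nonneg_left (sum_comp_le_sum hw hκ) hdpos.le)
    rw [hcast, ← mul_assoc] at h1
    have h2 := le_of_mul_le_mul_right h1 hwpos
    rw [mul_one_div, div_le_iff₀ hσpos] at h2
    rw [div_le_iff₀ hdpos]
    linarith
  refine ⟨hle, fun h => ?_, ?_⟩
  · have hkσ : ((n - s : ℕ) : ℝ) = σ * d := by
      rw [hcast, h, div_mul_cancel₀ _ hdpos.ne']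
    obtain ⟨h1, h2⟩ := weight_eq_of_pairing_of_eq hd hw hκ hpair
      (by rw [hkσ]; field_simp)
    obtain ⟨g, ι, hg, hι, heq⟩ := exists_form_of_weight_eq hf
      (mul_pos (one_div_pos.2 hσpos) hwpos) hN' hκ h1 h2
    refine ⟨g, ι, ⟨hg, ?_⟩, hι, heq⟩
    refine critLocus_eq_singleton_of_rename hsn (by omega) hg hι.injective ?_
    rw [homogeneousComponent_eq_sub_const hd0 (heq ▸ hg.rename_isHomogeneous), heq] at hs
    exact hs
  · rintro ⟨g, ι, hg, hι, h⟩
    refine le_antisymm ?_ hle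
    rw [← hcast]
    exact hσ.le_of_eq_rename hd0 hg.1 hι.injective h
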